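/- Let $G$ be a finite connected simple undirected graph with vertex set $\{0,1,\dots,N-1\}$ and Laplacian matrix $L=D-A$ ($D$ the diagonal degree matrix, $A$ the adjacency matrix). Let $0=\lambda_0<\lambda_1\le\dots\le\lambda_{N-1}$ be the eigenvalues of $L$, listed with multiplicity, let $u_0,\dots,u_{N-1}$ be an orthonormal basis of $\mathbb{R}^N$ with $Lu_i=\lambda_iu_i$, and let $u_{ij}$ be the $j$-th entry of $u_i$. Consider the noisy second-order consensus dynamics $$\begin{bmatrix}\dot x_1(t)\\ \dot x_2(t)\end{bmatrix}=\begin{bmatrix}0&I\\-L&-L\end{bmatrix}\begin{bmatrix}x_1(t)\\x_2(t)\end{bmatrix}+\begin{bmatrix}0\\I\end{bmatrix}w(t),\qquad t\ge 0,$$ where $x_1(t),x_2(t)\in\mathbb{R}^N$ and $w$ is an $N$-vector of uncorrelated Gaussian white noise processes of unit intensity; that is, $dx_1=x_2\,dt$ and $dx_2=-(Lx_1+Lx_2)\,dt+dW$ for a standard $N$-dimensional Brownian motion $W$. Let $(x_1,x_2)$ be any solution with continuous paths whose (possibly random) initial state has finite second moments, and let $\bar x_1(t)=\frac1N\sum_{k=0}^{N-1}x_{1k}(t)$.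 Then for every vertex $j$ the expectation $\mathbb{E}\left[(x_{1j}(t)-\bar x_1(t))^2\right]$ is finite for all $t\ge 0$, and the steady-state vertex variance $$H_{\mathrm{SO}}(j)=\lim_{t\to\infty}\mathbb{E}\left[(x_{1j}(t)-\bar x_1(t))^2\right]$$ exists and equals $$H_{\mathrm{SO}}(j)=\sum_{i=1}^{N-1}\frac{u_{ij}^2}{2\lambda_i^2}.$$ -/

import Mathlib

open MeasureTheory ProbabilityTheory Filter Topology
open scoped NNReal Matrix

namespace SecondOrderConsensus

/-- A standard Brownian motion with coordinates indexed by `ι`: a family of mutually independent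
standard real Brownian motions. Its formal derivative is a vector `w` of uncorrelated Gaussian white
noise processes of unit intensity. -/
structure IsStandardBrownian {Ω : Type*} [MeasurableSpace Ω] {ι : Type*}
    (W : ι → ℝ≥0 → Ω → ℝ) (P : Measure Ω) : Prop where
  brownian : ∀ i, IsBrownianReal (W i) P
  indep : iIndepFun (fun (i : ι) (ω : Ω) (t : ℝ≥0) => W i t ω) P

/-- The process `X`, considered on the times `t ≥ 0`, is a solution of the linear stochastic
differential equation `dX = A X dt + B dW`: it has continuous paths and satisfies the integrated
equation `X t = X 0 + ∫₀ᵗ A X s ds + B W t` for all `t ≥ 0`, almost surely. Since the noise is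
additive, no stochastic integral is needed. -/
structure IsLinearSDESolution {Ω : Type*} [MeasurableSpace Ω] {κ ι : Type*} [Fintype κ] [Fintype ι]
    (A : Matrix κ κ ℝ) (B : Matrix κ ι ℝ) (W : ι → ℝ≥0 → Ω → ℝ) (P : Measure Ω)
    (X : ℝ → Ω → κ → ℝ) : Prop where
  aemeasurable : ∀ t, 0 ≤ t → AEMeasurable (X t) P
  continuousOn : ∀ᵐ ω ∂P, ContinuousOn (fun t => X t ω) (Set.Ici 0)
  eqn : ∀ᵐ ω ∂P, ∀ t, 0 ≤ t → ∀ k : κ,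
    X t ω k = X 0 ω k + (∫ s in (0 : ℝ)..t, (A *ᵥ X s ω) k) + (B *ᵥ fun i => W i t.toNNReal ω) k

variable {N : ℕ}

/-- The matrix `[[0, I], [-L, -L]]`, where `L` is the Laplacian of `G`. -/
def systemMatrix (G : SimpleGraph (Fin N)) [DecidableRel G.Adj] :
    Matrix (Fin N ⊕ Fin N) (Fin N ⊕ Fin N) ℝ :=
  Matrix.fromBlocks 0 1 (-G.lapMatrix ℝ) (-G.lapMatrix ℝ)

/-- The matrix `[0; I]`. -/
def inputMatrix (N : ℕ) : Matrix (Fin N ⊕ Fin N) (Fin N) ℝ :=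
  Matrix.fromRows 0 1

/-- `X = (x₁, x₂)` solves the noisy second-order consensus dynamics
`ẋ₁ = x₂`, `ẋ₂ = -L x₁ - L x₂ + w`, where `w` is the white noise `dW/dt`. -/
def IsConsensusSolution {Ω : Type*} [MeasurableSpace Ω] (G : SimpleGraph (Fin N))
    [DecidableRel G.Adj] (W : Fin N → ℝ≥0 → Ω → ℝ) (P : Measure Ω)
    (X : ℝ → Ω → Fin N ⊕ Fin N → ℝ) : Prop :=
  IsLinearSDESolution (systemMatrix G) (inputMatrix N) W P X

/-- The deviation `x₁ⱼ - x̄₁` of the state of vertex `j` from the average of all vertex states. -/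
noncomputable def deviation (x : Fin N ⊕ Fin N → ℝ) (j : Fin N) : ℝ :=
  x (Sum.inl j) - (1 / (N : ℝ)) * ∑ k, x (Sum.inl k)

/-- `v` is the vertex variance of `j`: the expectation of `(x₁ⱼ(t) - x̄₁(t))²` is finite for every
`t ≥ 0` and tends to `v` as `t → ∞`. -/
def HasVertexVariance {Ω : Type*} [MeasurableSpace Ω] (P : Measure Ω)
    (X : ℝ → Ω → Fin N ⊕ Fin N → ℝ) (j : Fin N) (v : ℝ) : Prop :=
  (∀ t, 0 ≤ t → Integrable (fun ω => deviation (X t ω) j ^ 2) P) ∧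
    Tendsto (fun t : ℝ => ∫ ω, deviation (X t ω) j ^ 2 ∂P) atTop (𝓝 v)

/-- `lam 0 ≤ … ≤ lam (N - 1)` are the eigenvalues of the Laplacian of `G`, listed with multiplicity,
and `u 0, …, u (N - 1)` is an orthonormal basis of corresponding eigenvectors. -/
structure IsLaplacianEigensystem (G : SimpleGraph (Fin N)) [DecidableRel G.Adj]
    (lam : Fin N → ℝ) (u : OrthonormalBasis (Fin N) ℝ (EuclideanSpace ℝ (Fin N))) : Prop where
  monotone : Monotone lam
  eigen : ∀ i, G.lapMatrix ℝ *ᵥ (u i).ofLp = lam i • (u i).ofLp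

end SecondOrderConsensus

namespace SecondOrderConsensus

/-! Projecting the dynamics on an eigenvector `u i` decouples them into scalar oscillators `y'' + λ
y' + λ y = noise`, with `λ = lam i`. Subtracting the average removes exactly the constant mode, and
connectedness makes every other eigenvalue positive, so all remaining modes are damped.

Variation of constants (`IsImpulseResponse.eq_of_integral_equation`) writes the deviation at time
`t` as a combination of the initial data with decaying coefficients plus the Wiener integral of `∑
i, u i j * φ i (t - s) * u i k` against the Brownian motions `W k`. By
`IsStandardBrownian.wiener_isometry` and Parseval's identity, the second moment of the noise term is
`∑ i, u i j ^ 2 * ∫₀ᵗ φ i ^ 2`. A quadratic form whose derivative along the oscillator is `-φ ^ 2`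
evaluates the limit of that integral as `1 / (2 λ ^ 2)` (`IsImpulseResponse.tendsto_integral_sq`).
The initial data vanish in mean square, hence by Cauchy–Schwarz so does the cross term; no
independence of the initial state from the noise is needed.

The Wiener integral is handled after integration by parts, as an ordinary integral of Brownian
paths, so only the covariance `min s r` and Fubini enter. -/

/-! ### The scalar damped oscillator -/

/-- `φ` is the impulse response of `y'' + a y' + a y = 0`, and `ψ` its derivative. -/
structure IsImpulseResponse (a : ℝ) (φ ψ : ℝ → ℝ) : Prop where
  zero : φ 0 = 0
  deriv_zero : ψ 0 = 1
  hasDerivAt : ∀ t, HasDerivAt φ (ψ t) t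
  hasDerivAt_deriv : ∀ t, HasDerivAt ψ (-a * φ t - a * ψ t) t

/-- The exponential of the companion matrix, applied to the initial state `(0, 1)`, gives both
functions without distinguishing the sign of the discriminant `a ^ 2 - 4 * a`. -/
theorem exists_isImpulseResponse (a : ℝ) : ∃ φ ψ : ℝ → ℝ, IsImpulseResponse a φ ψ := by
  let A : (ℝ × ℝ) →L[ℝ] (ℝ × ℝ) :=
    (ContinuousLinearMap.snd ℝ ℝ ℝ).prod
      ((-a) • ContinuousLinearMap.fst ℝ ℝ ℝ - a • ContinuousLinearMap.snd ℝ ℝ ℝ)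
  let x : ℝ → ℝ × ℝ := fun t => NormedSpace.exp (t • A) (0, 1)
  have hx : ∀ t, HasDerivAt x (A (x t)) t := fun t => by
    have h := hasDerivAt_exp_smul_const' A t
    exact h.clm_apply (hasDerivAt_const t ((0, 1) : ℝ × ℝ)) |>.congr_deriv (by simp [x])
  have h0 : x 0 = (0, 1) := by simp [x]
  refine ⟨fun t => (x t).1, fun t => (x t).2, by simp [h0], by simp [h0], fun t => ?_, fun t => ?_⟩
  · exact ((ContinuousLinearMap.fst ℝ ℝ ℝ).hasFDerivAt.comp_hasDerivAt t (hx t))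
  · exact ((ContinuousLinearMap.snd ℝ ℝ ℝ).hasFDerivAt.comp_hasDerivAt t (hx t))

namespace IsImpulseResponse

variable {a : ℝ} {φ ψ : ℝ → ℝ}

theorem continuous (h : IsImpulseResponse a φ ψ) : Continuous φ :=
  continuous_iff_continuousAt.2 fun t => (h.hasDerivAt t).continuousAt

theorem continuous_deriv (h : IsImpulseResponse a φ ψ) : Continuous ψ :=
  continuous_iff_continuousAt.2 fun t => (h.hasDerivAt_deriv t).continuousAt

/-- The derivative of a quadratic form along the impulse response. -/
theorem hasDerivAt_quadratic (h : IsImpulseResponse a φ ψ) (α β γ t : ℝ) :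
    HasDerivAt (fun t => α * φ t ^ 2 + 2 * β * (φ t * ψ t) + γ * ψ t ^ 2)
      (-(2 * a * β) * φ t ^ 2 + 2 * (α - a * β - a * γ) * (φ t * ψ t)
        + 2 * (β - a * γ) * ψ t ^ 2) t := by
  have h1 := h.hasDerivAt t
  have h2 := h.hasDerivAt_deriv t
  refine ((((h1.pow 2).const_mul α).add ((h1.mul h2).const_mul (2 * β))).add
    ((h2.pow 2).const_mul γ)).congr_deriv ?_
  push_cast
  ring

theorem tendsto_sq_add_sq (h : IsImpulseResponse a φ ψ) (ha : 0 < a) :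
    Tendsto (fun t => φ t ^ 2 + ψ t ^ 2) atTop (𝓝 0) := by
  -- A Lyapunov function `V` with `V' = -(φ² + ψ²)`.
  set β := 1 / (2 * a) with hβ
  set γ := (β + 1 / 2) / a with hγ
  set α := a * (β + γ) with hα
  have hβ0 : 0 < β := by positivity
  have hγ0 : 0 < γ := by positivity
  have hα0 : 0 < α := by positivity
  have e1 : a * β = 1 / 2 := by rw [hβ]; field_simp
  have e2 : a * γ = β + 1 / 2 := by rw [hγ]; field_simp
  have e3 : α = 1 / 2 + (β + 1 / 2) := by rw [hα, mul_add, e1, e2]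
  set V : ℝ → ℝ := fun t => α * φ t ^ 2 + 2 * β * (φ t * ψ t) + γ * ψ t ^ 2 with hV
  have hVd : ∀ t, HasDerivAt V (-(φ t ^ 2 + ψ t ^ 2)) t := fun t => by
    refine (h.hasDerivAt_quadratic α β γ t).congr_deriv ?_
    linear_combination (-2 * φ t ^ 2 - 2 * φ t * ψ t) * e1 - (2 * φ t * ψ t + 2 * ψ t ^ 2) * e2
      + 2 * φ t * ψ t * e3
  have hdet : 0 < α * γ - β ^ 2 := by
    have : γ = 2 * β * (β + 1 / 2) := by rw [hγ, hβ]; field_simp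
    rw [this, e3]; nlinarith [mul_pos hβ0 hβ0, mul_pos hβ0 (mul_pos hβ0 hβ0)]
  -- Determinant over trace bounds the smaller eigenvalue of the form `M` of `V` from below. By
  -- Cayley–Hamilton, `tr M * ⟨v, M v⟩ - det M * |v|² = |M v|²`, the sum of the two squares given to
  -- `nlinarith`.
  set c := (α * γ - β ^ 2) / (α + γ) with hc
  have hc0 : 0 < c := by positivity
  have hlow : ∀ t, c * (φ t ^ 2 + ψ t ^ 2) ≤ V t := fun t => by
    have : c * (φ t ^ 2 + ψ t ^ 2) * (α + γ) ≤ V t * (α + γ) := by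
      have : c * (α + γ) = α * γ - β ^ 2 := by rw [hc]; field_simp
      have h3 : c * (φ t ^ 2 + ψ t ^ 2) * (α + γ) = (α * γ - β ^ 2) * (φ t ^ 2 + ψ t ^ 2) := by
        rw [← this]; ring
      rw [h3]
      simp only [hV]
      nlinarith [sq_nonneg (α * φ t + β * ψ t), sq_nonneg (β * φ t + γ * ψ t)]
    exact le_of_mul_le_mul_right this (by positivity)
  set C := α + β + γ with hC
  have hC0 : 0 < C := by positivity
  have hup : ∀ t, V t ≤ C * (φ t ^ 2 + ψ t ^ 2) := fun t => by
    simp only [hV, hC]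
    nlinarith [mul_nonneg hβ0.le (sq_nonneg (φ t - ψ t)), mul_nonneg hα0.le (sq_nonneg (ψ t)),
      mul_nonneg hγ0.le (sq_nonneg (φ t))]
  -- Since `V ≤ C (φ² + ψ²) = -C V'`, Grönwall's argument gives decay of `V` at rate `1 / C`.
  have hE : Antitone fun t => Real.exp (t / C) * V t := by
    have hd : ∀ t, HasDerivAt (fun t => Real.exp (t / C) * V t)
        (Real.exp (t / C) * (1 / C) * V t + Real.exp (t / C) * (-(φ t ^ 2 + ψ t ^ 2))) t :=
      fun t => (((hasDerivAt_id t).div_const C).exp).mul (hVd t)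
    refine antitone_of_deriv_nonpos (fun t => (hd t).differentiableAt) fun t => ?_
    rw [(hd t).deriv]
    have : 1 / C * V t ≤ φ t ^ 2 + ψ t ^ 2 := by
      rw [one_div, inv_mul_le_iff₀ hC0]; exact hup t
    nlinarith [Real.exp_pos (t / C)]
  have hexp : Tendsto (fun t : ℝ => Real.exp (-(t / C)) * V 0 / c) atTop (𝓝 0) := by
    have h1 : Tendsto (fun t : ℝ => t / C) atTop atTop := tendsto_id.atTop_div_const hC0
    simpa using ((Real.tendsto_exp_neg_atTop_nhds_zero.comp h1).mul_const (V 0)).div_const c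
  refine squeeze_zero' (Eventually.of_forall fun t => by positivity) ?_ hexp
  filter_upwards [eventually_ge_atTop 0] with t ht
  have h1 : Real.exp (t / C) * V t ≤ V 0 := by simpa using hE ht
  have h2 : V t ≤ Real.exp (-(t / C)) * V 0 := by
    rw [Real.exp_neg, ← div_eq_inv_mul, le_div_iff₀' (Real.exp_pos _)]; exact h1
  rw [le_div_iff₀' hc0]
  exact (hlow t).trans h2

theorem tendsto_zero (h : IsImpulseResponse a φ ψ) (ha : 0 < a) : Tendsto φ atTop (𝓝 0) := by
  have h1 := (h.tendsto_sq_add_sq ha).sqrt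
  rw [Real.sqrt_zero] at h1
  exact squeeze_zero_norm (fun t => Real.abs_le_sqrt (by nlinarith [sq_nonneg (ψ t)])) h1

theorem tendsto_deriv_zero (h : IsImpulseResponse a φ ψ) (ha : 0 < a) :
    Tendsto ψ atTop (𝓝 0) := by
  have h1 := (h.tendsto_sq_add_sq ha).sqrt
  rw [Real.sqrt_zero] at h1
  exact squeeze_zero_norm (fun t => Real.abs_le_sqrt (by nlinarith [sq_nonneg (φ t)])) h1

/-- The squared `L²` norm of the impulse response is `1 / (2 a ^ 2)`. -/
theorem tendsto_integral_sq (h : IsImpulseResponse a φ ψ) (ha : 0 < a) :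
    Tendsto (fun t => ∫ s in (0 : ℝ)..t, φ s ^ 2) atTop (𝓝 (1 / (2 * a ^ 2))) := by
  -- The coefficients solve the linear system that makes `V' = -φ²` in `hasDerivAt_quadratic`. As `φ
  -- 0 = 0` and `ψ 0 = 1`, `V 0` is the coefficient of `ψ²`, which is the value of the limit.
  set V : ℝ → ℝ := fun t => (1 / 2 + 1 / (2 * a)) * φ t ^ 2 + 2 * (1 / (2 * a)) * (φ t * ψ t)
    + 1 / (2 * a ^ 2) * ψ t ^ 2 with hV
  have hd : ∀ t, HasDerivAt (fun t => -V t) (φ t ^ 2) t := fun t => by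
    refine (h.hasDerivAt_quadratic _ _ _ t).neg.congr_deriv ?_
    field_simp
    ring
  have hint : ∀ t, ∫ s in (0 : ℝ)..t, φ s ^ 2 = 1 / (2 * a ^ 2) - V t := fun t => by
    rw [intervalIntegral.integral_eq_sub_of_hasDerivAt (fun s _ => hd s)
      ((h.continuous.pow 2).intervalIntegrable _ _)]
    simp only [hV, h.zero, h.deriv_zero]
    ring
  simp_rw [hint]
  have h1 := h.tendsto_zero ha
  have h2 := h.tendsto_deriv_zero ha
  have : Tendsto V atTop (𝓝 0) := by
    have h3 := (((h1.pow 2).const_mul (1 / 2 + 1 / (2 * a))).add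
      ((h1.mul h2).const_mul (2 * (1 / (2 * a))))).add ((h2.pow 2).const_mul (1 / (2 * a ^ 2)))
    convert h3 using 2
    simp
  have h4 := this.const_sub (1 / (2 * a ^ 2))
  rwa [sub_zero] at h4

/-- Variation of constants for `y' = z`, `z = z 0 - a ∫ (y + z) + b`. -/
theorem eq_of_integral_equation (h : IsImpulseResponse a φ ψ) {y z b : ℝ → ℝ}
    (hy : ContinuousOn y (Set.Ici 0)) (hz : ContinuousOn z (Set.Ici 0))
    (hb : ContinuousOn b (Set.Ici 0)) (hb0 : b 0 = 0)
    (ey : ∀ t, 0 ≤ t → y t = y 0 + ∫ s in (0 : ℝ)..t, z s)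
    (ez : ∀ t, 0 ≤ t → z t = z 0 + (∫ s in (0 : ℝ)..t, (-a * y s - a * z s)) + b t)
    {t : ℝ} (ht : 0 ≤ t) :
    y t = (ψ t + a * φ t) * y 0 + φ t * z 0 + ∫ s in (0 : ℝ)..t, ψ (t - s) * b s := by
  have key : ∀ {f : ℝ → ℝ}, ContinuousOn f (Set.Ici 0) → ∀ s, 0 < s →
      HasDerivAt (fun t => ∫ s in (0 : ℝ)..t, f s) (f s) s := fun {f} hf s hs =>
    intervalIntegral.integral_hasDerivAt_right
      ((hf.mono (by rw [Set.uIcc_of_le hs.le]; exact Set.Icc_subset_Ici_self)).intervalIntegrable)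
      ((hf.mono Set.Ioi_subset_Ici_self).stronglyMeasurableAtFilter isOpen_Ioi s hs)
      (hf.continuousAt (Ici_mem_nhds hs))
  have dy : ∀ s, 0 < s → HasDerivAt y (z s) s := fun s hs =>
    ((key hz s hs).const_add (y 0)).congr_of_eventuallyEq <| by
      filter_upwards [Ici_mem_nhds hs] with r hr using ey r hr
  -- The forcing `b` will be a Brownian path, so `z` need not be differentiable; `z - b` is.
  have dv : ∀ s, 0 < s → HasDerivAt (fun s => z s - b s) (-a * y s - a * z s) s := fun s hs =>
    ((key ((hy.const_smul (-a)).sub (hz.const_smul a)) s hs).const_add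
      (z 0)).congr_of_eventuallyEq <| by
        filter_upwards [Ici_mem_nhds hs] with r hr
        rw [ez r hr]; simp
  have hsub : Set.Icc 0 t ⊆ Set.Ici 0 := Set.Icc_subset_Ici_self
  have hφ : Continuous fun s => φ (t - s) := h.continuous.comp (by fun_prop)
  have hψ : Continuous fun s => ψ (t - s) := h.continuous_deriv.comp (by fun_prop)
  -- Pairing the state with the adjoint solution run backwards from `t` cancels all terms of the
  -- derivative except the forcing. The pairing equals `y t` at `s = t` and the free response at `s
  -- = 0`.
  have hI := intervalIntegral.integral_eq_sub_of_hasDerivAt_of_le ht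
    (f := fun s => (ψ (t - s) + a * φ (t - s)) * y s + φ (t - s) * (z s - b s))
    (f' := fun s => ψ (t - s) * b s) ?_ ?_ ?_
  · rw [hI]
    simp only [sub_self, sub_zero, h.zero, h.deriv_zero, hb0]
    ring
  · exact ((hψ.add (hφ.const_mul a)).continuousOn.mul (hy.mono hsub)).add
      (hφ.continuousOn.mul ((hz.mono hsub).sub (hb.mono hsub)))
  · intro s hs
    have e : HasDerivAt (fun s : ℝ => t - s) (-1) s := by
      simpa using (hasDerivAt_id s).const_sub t
    have d1 : HasDerivAt (fun s => φ (t - s)) (ψ (t - s) * -1) s := (h.hasDerivAt _).comp s e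
    have d2 : HasDerivAt (fun s => ψ (t - s)) ((-a * φ (t - s) - a * ψ (t - s)) * -1) s :=
      (h.hasDerivAt_deriv _).comp s e
    refine (((d2.add (d1.const_mul a)).mul (dy s hs.1)).add (d1.mul (dv s hs.1))).congr_deriv ?_
    simp only [Pi.add_apply]
    ring
  · exact (hψ.continuousOn.mul (hb.mono (by
      rw [Set.uIcc_of_le ht]; exact hsub))).intervalIntegrable

end IsImpulseResponse

/-! ### Measurable versions and second moments of time integrals -/

/-- A process with almost surely continuous paths agrees almost surely, at all times, with a
measurable process all of whose paths are continuous. -/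
theorem exists_continuous_measurable_version {T Ω : Type*} [TopologicalSpace T]
    [TopologicalSpace.SeparableSpace T] [FirstCountableTopology T] [Nonempty T] [MeasurableSpace Ω]
    {P : Measure Ω} {W : T → Ω → ℝ} (hm : ∀ t, AEMeasurable (W t) P)
    (hc : ∀ᵐ ω ∂P, Continuous fun t => W t ω) :
    ∃ V : T → Ω → ℝ, (∀ t, Measurable (V t)) ∧ (∀ ω, Continuous fun t => V t ω) ∧
      ∀ᵐ ω ∂P, ∀ t, V t ω = W t ω := by
  let d := TopologicalSpace.denseSeq T
  have hae : ∀ᵐ ω ∂P, (Continuous fun t => W t ω) ∧ ∀ n, W (d n) ω = (hm (d n)).mk _ ω :=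
    hc.and (ae_all_iff.2 fun n => (hm (d n)).ae_eq_mk)
  -- The good event may fail to be measurable; removing the measurable hull of its complement leaves
  -- a measurable event of full measure inside it.
  obtain ⟨S, hSP, hSm, hS⟩ : ∃ S ∈ ae P, MeasurableSet S ∧
      ∀ ω ∈ S, (Continuous fun t => W t ω) ∧ ∀ n, W (d n) ω = (hm (d n)).mk _ ω := by
    obtain ⟨S', hS', h⟩ := eventually_iff_exists_mem.1 hae
    refine ⟨(toMeasurable P S'ᶜ)ᶜ, ?_, (measurableSet_toMeasurable _ _).compl,
      fun ω hω => h ω (not_not.1 fun hn => hω (subset_toMeasurable P _ hn))⟩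
    rwa [mem_ae_iff, compl_compl, measure_toMeasurable, ← mem_ae_iff]
  refine ⟨fun t => S.indicator (W t), fun t => ?_, fun ω => ?_, ?_⟩
  -- Continuity on `S` exhibits the value at `t` as a limit of measurable values at points of the
  -- dense sequence.
  · obtain ⟨x, hx, hxt⟩ := mem_closure_iff_seq_limit.1
      ((TopologicalSpace.denseRange_denseSeq T).closure_range ▸ Set.mem_univ t :
        t ∈ closure (Set.range d))
    choose n hn using hx
    refine measurable_of_tendsto_metrizable (f := fun k => S.indicator ((hm (d (n k))).mk _))
      (fun k => ((hm _).measurable_mk).indicator hSm) (tendsto_pi_nhds.2 fun ω => ?_)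
    by_cases hω : ω ∈ S
    · simp only [Set.indicator_of_mem hω]
      have := ((hS ω hω).1.tendsto t).comp hxt
      refine this.congr fun k => ?_
      rw [Function.comp_apply, ← hn]
      exact (hS ω hω).2 _
    · simp [Set.indicator_of_notMem hω]
  · by_cases hω : ω ∈ S
    · simpa [Set.indicator_of_mem hω] using (hS ω hω).1
    · simp [Set.indicator_of_notMem hω, continuous_const]
  · filter_upwards [hSP] with ω hω t
    simp [Set.indicator_of_mem hω]

section SecondMoment

variable {T Ω : Type*} [MeasurableSpace T] [MeasurableSpace Ω] {P : Measure Ω}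
  [IsProbabilityMeasure P] {ν : Measure T} [IsFiniteMeasure ν] {H : T → Ω → ℝ}

/-- The bound `|H s * H r| ≤ H s ^ 2 + H r ^ 2` reduces integrability to the finite measure `ν` and
the diagonal second moments. This is the Fubini hypothesis for squaring a time integral and
exchanging it with the expectation. -/
theorem integrable_mul_prod (hH : Measurable (Function.uncurry H)) (h2 : ∀ s, MemLp (H s) 2 P)
    (hint : Integrable (fun s => ∫ ω, H s ω ^ 2 ∂P) ν) :
    Integrable (fun q : (T × T) × Ω => H q.1.1 q.2 * H q.1.2 q.2) ((ν.prod ν).prod P) := by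
  have hF : Measurable fun q : (T × T) × Ω => H q.1.1 q.2 * H q.1.2 q.2 :=
    (hH.comp (by fun_prop : Measurable fun q : (T × T) × Ω => (q.1.1, q.2))).mul
      (hH.comp (by fun_prop : Measurable fun q : (T × T) × Ω => (q.1.2, q.2)))
  rw [integrable_prod_iff hF.aestronglyMeasurable]
  refine ⟨Eventually.of_forall fun p => (h2 p.1).integrable_mul (h2 p.2), ?_⟩
  refine ((hint.comp_fst ν).add (hint.comp_snd ν)).mono'
    hF.aestronglyMeasurable.norm.integral_prod_right' (Eventually.of_forall fun p => ?_)
  rw [Real.norm_of_nonneg (integral_nonneg fun _ => norm_nonneg _), Pi.add_apply,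
    ← integral_add (h2 p.1).integrable_sq (h2 p.2).integrable_sq]
  refine integral_mono ((h2 p.1).integrable_mul (h2 p.2)).norm
    ((h2 p.1).integrable_sq.add (h2 p.2).integrable_sq) fun ω => ?_
  simp only [Real.norm_eq_abs, abs_mul]
  nlinarith [sq_nonneg (|H p.1 ω| - |H p.2 ω|), sq_abs (H p.1 ω), sq_abs (H p.2 ω),
    abs_nonneg (H p.1 ω), abs_nonneg (H p.2 ω)]

theorem memLp_two_integral (hH : Measurable (Function.uncurry H)) (h2 : ∀ s, MemLp (H s) 2 P)
    (hint : Integrable (fun s => ∫ ω, H s ω ^ 2 ∂P) ν) :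
    MemLp (fun ω => ∫ s, H s ω ∂ν) 2 P := by
  have hm : AEStronglyMeasurable (fun ω => ∫ s, H s ω ∂ν) P :=
    (hH.stronglyMeasurable.integral_prod_left' (μ := ν)).aestronglyMeasurable
  rw [memLp_two_iff_integrable_sq hm]
  refine (integrable_mul_prod hH h2 hint).integral_prod_right.congr
    (Eventually.of_forall fun ω => ?_)
  simp only [sq]
  exact integral_prod_mul (fun s => H s ω) (fun s => H s ω)

theorem integral_sq_integral (hH : Measurable (Function.uncurry H)) (h2 : ∀ s, MemLp (H s) 2 P)
    (hint : Integrable (fun s => ∫ ω, H s ω ^ 2 ∂P) ν) :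
    ∫ ω, (∫ s, H s ω ∂ν) ^ 2 ∂P = ∫ s, ∫ r, ∫ ω, H s ω * H r ω ∂P ∂ν ∂ν := by
  have hI := integrable_mul_prod hH h2 hint
  rw [← integral_prod (fun p : T × T => ∫ ω, H p.1 ω * H p.2 ω ∂P) hI.integral_prod_left,
    integral_integral_swap hI]
  refine integral_congr_ae (Eventually.of_forall fun ω => ?_)
  simp only [sq]
  exact (integral_prod_mul (fun s => H s ω) (fun s => H s ω)).symm

end SecondMoment

/-! ### The Itô isometry for smooth deterministic integrands -/

/-- The integrated covariance kernel `min` of Brownian motion, with a weight `-F'` where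
`F t = 0`. -/
theorem integral_integral_mul_min {F K : ℝ → ℝ} (hF : ∀ s, HasDerivAt F (-K s) s)
    (hK : Continuous K) {t : ℝ} (ht : 0 ≤ t) (hFt : F t = 0) :
    ∫ s in (0 : ℝ)..t, ∫ r in (0 : ℝ)..t, K s * K r * min s r = ∫ s in (0 : ℝ)..t, F s ^ 2 := by
  have hFc : Continuous F := continuous_iff_continuousAt.2 fun s => (hF s).continuousAt
  have hG : ∀ s, HasDerivAt (fun s => ∫ r in (0 : ℝ)..s, F r) (F s) s := fun s =>
    (hFc.integral_hasStrictDerivAt 0 s).hasDerivAt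
  have hGc : Continuous fun s => ∫ r in (0 : ℝ)..s, F r :=
    continuous_iff_continuousAt.2 fun s => (hG s).continuousAt
  -- Splitting at `r = s` and integrating each piece by parts, the boundary terms `F s * s` cancel
  -- and the one at `t` vanishes by `F t = 0`.
  have inner : ∀ s ∈ Set.uIcc 0 t, ∫ r in (0 : ℝ)..t, K s * K r * min s r
      = K s * ∫ r in (0 : ℝ)..s, F r := fun s hs => by
    rw [Set.uIcc_of_le ht] at hs
    simp_rw [mul_assoc]
    rw [intervalIntegral.integral_const_mul]
    congr 1
    have hc : Continuous fun r => K r * min s r := by fun_prop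
    rw [← intervalIntegral.integral_add_adjacent_intervals (hc.intervalIntegrable 0 s)
      (hc.intervalIntegrable s t)]
    have e1 : ∫ r in (0 : ℝ)..s, K r * min s r = (∫ r in (0 : ℝ)..s, F r) - F s * s := by
      have : ∫ r in (0 : ℝ)..s, K r * min s r
          = ((∫ r in (0 : ℝ)..s, F r) - F s * s) - ((∫ r in (0 : ℝ)..0, F r) - F 0 * 0) := by
        rw [← intervalIntegral.integral_eq_sub_of_hasDerivAt
          (f := fun s => (∫ r in (0 : ℝ)..s, F r) - F s * s) (f' := fun s => K s * s)
          (fun r _ => ((hG r).sub ((hF r).mul (hasDerivAt_id r))).congr_deriv (by simp))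
          ((hK.mul continuous_id).intervalIntegrable _ _)]
        refine intervalIntegral.integral_congr fun r hr => ?_
        rw [Set.uIcc_of_le hs.1] at hr
        simp only [min_eq_right hr.2]
      simpa using this
    have e2 : ∫ r in s..t, K r * min s r = F s * s := by
      have : ∫ r in s..t, K r * min s r = -(F t * s) - -(F s * s) := by
        rw [← intervalIntegral.integral_eq_sub_of_hasDerivAt
          (f := fun r => -(F r * s)) (f' := fun r => K r * s)
          (fun r _ => ((hF r).mul_const s).neg.congr_deriv (by ring))
          ((hK.mul continuous_const).intervalIntegrable _ _)]
        refine intervalIntegral.integral_congr fun r hr => ?_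
        rw [Set.uIcc_of_le hs.2] at hr
        simp only [min_eq_left hr.1]
      simpa [hFt] using this
    rw [e1, e2]; ring
  have i1 : Continuous fun s => K s * ∫ r in (0 : ℝ)..s, F r := hK.mul hGc
  have i2 : Continuous fun s => F s ^ 2 := hFc.pow 2
  -- A second integration by parts moves the derivative from `F` to its primitive; the boundary
  -- terms vanish because `F t = 0` and the primitive is zero at `0`.
  rw [intervalIntegral.integral_congr inner, ← sub_eq_zero, ← intervalIntegral.integral_sub
    (i1.intervalIntegrable _ _) (i2.intervalIntegrable _ _),
    intervalIntegral.integral_eq_sub_of_hasDerivAt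
      (f := fun s => -(F s * ∫ r in (0 : ℝ)..s, F r))
      (f' := fun s => (K s * ∫ r in (0 : ℝ)..s, F r) - F s ^ 2)
      (fun s _ => ((hF s).mul (hG s)).neg.congr_deriv (by ring))
      ((i1.sub i2).intervalIntegrable _ _)]
  simp [hFt]

theorem IsStandardBrownian.covariance {Ω ι : Type*} [MeasurableSpace Ω] [DecidableEq ι]
    {P : Measure Ω} {W : ι → ℝ≥0 → Ω → ℝ} (hW : IsStandardBrownian W P) (k l : ι) (s r : ℝ≥0) :
    ∫ ω, W k s ω * W l r ω ∂P = if k = l then ((min s r : ℝ≥0) : ℝ) else 0 := by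
  have hP : IsProbabilityMeasure P := ((hW.brownian k).hasLaw_eval 0).isProbabilityMeasure
  have hL : ∀ k s, MemLp (W k s) 2 P := fun k s =>
    ((hW.brownian k).hasLaw_eval s).hasGaussianLaw.memLp_two
  have hcov := covariance_eq_sub (hL k s) (hL l r)
  rw [(hW.brownian k).integral_eval, zero_mul, sub_zero] at hcov
  refine hcov.symm.trans ?_
  split_ifs with h
  · subst h
    exact (hW.brownian k).covariance_eval s r
  · exact ((hW.indep.indepFun h).comp (measurable_pi_apply s)
      (measurable_pi_apply r)).covariance_eq_zero (hL k s) (hL l r)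

/-- The Wiener integral `∑ k, ∫₀ᵗ F k dW k = ∫₀ᵗ ∑ k, K k s * W k s ds`, where `F k' = -K k` and
`F k t = 0`, is square integrable and satisfies the Itô isometry. -/
theorem IsStandardBrownian.wiener_isometry {Ω ι : Type*} [MeasurableSpace Ω] [Fintype ι]
    {P : Measure Ω} [IsProbabilityMeasure P] {W : ι → ℝ≥0 → Ω → ℝ} (hW : IsStandardBrownian W P)
    {F K : ι → ℝ → ℝ} (hF : ∀ k s, HasDerivAt (F k) (-K k s) s) (hK : ∀ k, Continuous (K k))
    {t : ℝ} (ht : 0 ≤ t) (hFt : ∀ k, F k t = 0) :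
    MemLp (fun ω => ∫ s in (0 : ℝ)..t, ∑ k, K k s * W k s.toNNReal ω) 2 P ∧
      ∫ ω, (∫ s in (0 : ℝ)..t, ∑ k, K k s * W k s.toNNReal ω) ^ 2 ∂P
        = ∑ k, ∫ s in (0 : ℝ)..t, F k s ^ 2 := by
  classical
  -- Brownian paths are continuous only almost surely and each time marginal is only a.e.
  -- measurable. Versions with all paths continuous give the joint measurability that Fubini
  -- requires.
  choose V hVm hVc hV using fun k =>
    exists_continuous_measurable_version (fun s => (hW.brownian k).aemeasurable s)
      (hW.brownian k).cont
  have hVk : ∀ k s, V k s =ᵐ[P] W k s := fun k s => (hV k).mono fun ω h => h s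
  have hVL : ∀ k s, MemLp (V k s) 2 P := fun k s =>
    ((hW.brownian k).hasLaw_eval s).hasGaussianLaw.memLp_two.ae_eq (hVk k s).symm
  have hcov : ∀ k l s r, ∫ ω, V k s ω * V l r ω ∂P
      = if k = l then ((min s r : ℝ≥0) : ℝ) else 0 := fun k l s r => by
    rw [← hW.covariance k l s r]
    exact integral_congr_ae ((hVk k s).mul (hVk l r))
  set H : ℝ → Ω → ℝ := fun s ω => ∑ k, K k s * V k s.toNNReal ω with hHdef
  have hHm : Measurable (Function.uncurry H) :=
    measurable_uncurry_of_continuous_of_measurable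
      (fun ω => continuous_finsetSum _ fun k _ =>
        (hK k).mul ((hVc k ω).comp continuous_real_toNNReal))
      (fun s => Finset.measurable_sum _ fun k _ => (hVm k _).const_mul _)
  have hH2 : ∀ s, MemLp (H s) 2 P := fun s =>
    memLp_finsetSum _ fun k _ => (hVL k _).const_mul _
  have hHH : ∀ s r, ∫ ω, H s ω * H r ω ∂P
      = ∑ k, K k s * K k r * ((min s.toNNReal r.toNNReal : ℝ≥0) : ℝ) := fun s r => by
    simp only [hHdef, Finset.sum_mul_sum]
    have hi : ∀ k l, Integrable
        (fun ω => K k s * V k s.toNNReal ω * (K l r * V l r.toNNReal ω)) P := fun k l =>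
      ((hVL k _).const_mul _).integrable_mul ((hVL l _).const_mul _)
    rw [integral_finsetSum _ fun k _ => integrable_finsetSum _ fun l _ => hi k l]
    refine Finset.sum_congr rfl fun k _ => ?_
    rw [integral_finsetSum _ fun l _ => hi k l, Finset.sum_eq_single k]
    · simp_rw [mul_mul_mul_comm (K k s), integral_const_mul, hcov, if_true]
    · intro l _ hl
      simp_rw [mul_mul_mul_comm (K k s), integral_const_mul, hcov, if_neg hl.symm, mul_zero]
    · simp
  have hmin : ∀ s r : ℝ, 0 ≤ s → 0 ≤ r →
      ((min s.toNNReal r.toNNReal : ℝ≥0) : ℝ) = min s r := fun s r hs hr => by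
    rw [NNReal.coe_min, Real.coe_toNNReal s hs, Real.coe_toNNReal r hr]
  have hint : Integrable (fun s => ∫ ω, H s ω ^ 2 ∂P) (volume.restrict (Set.Ioc 0 t)) := by
    have : (fun s => ∫ ω, H s ω ^ 2 ∂P) = fun s => ∑ k, K k s * K k s * s.toNNReal := by
      funext s
      simp only [sq, hHH, min_self]
    rw [this]
    refine Continuous.integrableOn_Ioc ?_
    have := continuous_real_toNNReal
    fun_prop
  have hG : (fun ω => ∫ s in Set.Ioc 0 t, H s ω)
      =ᵐ[P] fun ω => ∫ s in (0 : ℝ)..t, ∑ k, K k s * W k s.toNNReal ω := by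
    filter_upwards [ae_all_iff.2 hV] with ω hω
    simp only [hHdef, hω, intervalIntegral.integral_of_le ht]
  refine ⟨(memLp_two_integral hHm hH2 hint).ae_eq hG, ?_⟩
  have hG2 : (fun ω => (∫ s in Set.Ioc 0 t, H s ω) ^ 2)
      =ᵐ[P] fun ω => (∫ s in (0 : ℝ)..t, ∑ k, K k s * W k s.toNNReal ω) ^ 2 := hG.pow_const 2
  rw [← integral_congr_ae hG2, integral_sq_integral hHm hH2 hint]
  simp_rw [← intervalIntegral.integral_of_le ht, hHH]
  have e : ∀ s ∈ Set.uIcc 0 t, (∫ r in (0 : ℝ)..t,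
      ∑ k, K k s * K k r * ((min s.toNNReal r.toNNReal : ℝ≥0) : ℝ))
      = ∑ k, ∫ r in (0 : ℝ)..t, K k s * K k r * min s r := fun s hs => by
    rw [Set.uIcc_of_le ht] at hs
    have hc : ∀ k, Continuous fun r => K k s * K k r * min s r := fun k => by
      have := hK k
      fun_prop
    rw [← intervalIntegral.integral_finsetSum fun k _ => (hc k).intervalIntegrable _ _]
    refine intervalIntegral.integral_congr fun r hr => ?_
    rw [Set.uIcc_of_le ht] at hr
    simp only [hmin s r hs.1 hr.1]
  rw [intervalIntegral.integral_congr e, intervalIntegral.integral_finsetSum]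
  · exact Finset.sum_congr rfl fun k _ => integral_integral_mul_min (hF k) (hK k) ht (hFt k)
  · intro k _
    refine Continuous.intervalIntegrable ?_ _ _
    refine intervalIntegral.continuous_parametric_intervalIntegral_of_continuous' ?_ _ _
    have := hK k
    fun_prop

/-! ### Limits of second moments -/

/-- A perturbation that vanishes in mean square does not change the limit of second moments. -/
theorem tendsto_integral_add_sq {Ω : Type*} [MeasurableSpace Ω] {P : Measure Ω}
    {h G : ℝ → Ω → ℝ} {v : ℝ} (hh : ∀ᶠ t in atTop, MemLp (h t) 2 P)
    (hG : ∀ᶠ t in atTop, MemLp (G t) 2 P)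
    (hh0 : Tendsto (fun t => ∫ ω, h t ω ^ 2 ∂P) atTop (𝓝 0))
    (hGv : Tendsto (fun t => ∫ ω, G t ω ^ 2 ∂P) atTop (𝓝 v)) :
    Tendsto (fun t => ∫ ω, (h t ω + G t ω) ^ 2 ∂P) atTop (𝓝 v) := by
  have hprod : Tendsto (fun t => ∫ ω, h t ω * G t ω ∂P) atTop (𝓝 0) := by
    have h1 := (hh0.mul hGv).sqrt
    rw [zero_mul, Real.sqrt_zero] at h1
    refine squeeze_zero_norm' ?_ h1
    filter_upwards [hh, hG] with t ht hGt
    refine Real.abs_le_sqrt ?_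
    -- Cauchy–Schwarz through the discriminant: the second moment of `x * h t + G t` is a
    -- nonnegative quadratic polynomial in `x`.
    have hi : ∀ x : ℝ, 0 ≤ (∫ ω, h t ω ^ 2 ∂P) * (x * x) + 2 * (∫ ω, h t ω * G t ω ∂P) * x
        + ∫ ω, G t ω ^ 2 ∂P := fun x => by
      have : ∫ ω, (x * h t ω + G t ω) ^ 2 ∂P = (∫ ω, h t ω ^ 2 ∂P) * (x * x)
          + 2 * (∫ ω, h t ω * G t ω ∂P) * x + ∫ ω, G t ω ^ 2 ∂P := by
        have i1 := ht.integrable_sq.mul_const (x * x)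
        have i2 : Integrable (fun ω => h t ω * G t ω * (2 * x)) P :=
          (ht.integrable_mul hGt).mul_const (2 * x)
        have i3 : Integrable
            (fun ω => h t ω ^ 2 * (x * x) + h t ω * G t ω * (2 * x)) P := i1.add i2
        rw [← integral_mul_const, show 2 * (∫ ω, h t ω * G t ω ∂P) * x
          = (∫ ω, h t ω * G t ω ∂P) * (2 * x) by ring, ← integral_mul_const,
          ← integral_add i1 i2, ← integral_add i3 hGt.integrable_sq]
        refine integral_congr_ae (Eventually.of_forall fun ω => ?_)
        ring
      rw [← this]
      exact integral_nonneg fun ω => sq_nonneg _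
    have := discrim_le_zero hi
    rw [discrim] at this
    nlinarith
  have h2 := (hh0.add (hprod.const_mul 2)).add hGv
  simp only [mul_zero, zero_add] at h2
  refine h2.congr' ?_
  filter_upwards [hh, hG] with t ht hGt
  have i2 : Integrable (fun ω => 2 * (h t ω * G t ω)) P := (ht.integrable_mul hGt).const_mul 2
  have i3 : Integrable (fun ω => h t ω ^ 2 + 2 * (h t ω * G t ω)) P := ht.integrable_sq.add i2
  rw [← integral_const_mul, ← integral_add ht.integrable_sq i2,
    ← integral_add i3 hGt.integrable_sq]
  refine integral_congr_ae (Eventually.of_forall fun ω => ?_)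
  ring

/-- A linear combination of fixed square integrable variables vanishes in mean square when its
coefficients do. -/
theorem tendsto_integral_sum_sq {Ω κ : Type*} [MeasurableSpace Ω] [Fintype κ] {P : Measure Ω}
    {ξ : κ → Ω → ℝ} (hξ : ∀ k, MemLp (ξ k) 2 P) {c : κ → ℝ → ℝ}
    (hc : ∀ k, Tendsto (c k) atTop (𝓝 0)) :
    Tendsto (fun t => ∫ ω, (∑ k, c k t * ξ k ω) ^ 2 ∂P) atTop (𝓝 0) := by
  have e : ∀ t, ∫ ω, (∑ k, c k t * ξ k ω) ^ 2 ∂P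
      = ∑ k, ∑ l, c k t * c l t * ∫ ω, ξ k ω * ξ l ω ∂P := fun t => by
    simp only [sq, Finset.sum_mul_sum, mul_mul_mul_comm _ (ξ _ _)]
    have hi : ∀ k l, Integrable (fun ω => c k t * c l t * (ξ k ω * ξ l ω)) P := fun k l =>
      ((hξ k).integrable_mul (hξ l)).const_mul _
    rw [integral_finsetSum _ fun k _ => integrable_finsetSum _ fun l _ => hi k l]
    refine Finset.sum_congr rfl fun k _ => ?_
    rw [integral_finsetSum _ fun l _ => hi k l]
    simp_rw [integral_const_mul]
  simp_rw [e]
  have := tendsto_finsetSum (Finset.univ : Finset κ) fun k _ =>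
    tendsto_finsetSum (Finset.univ : Finset κ) fun l _ =>
      ((hc k).mul (hc l)).mul_const (∫ ω, ξ k ω * ξ l ω ∂P)
  simpa using this

/-! ### Spectral theory of the Laplacian -/

namespace IsLaplacianEigensystem

variable {N : ℕ} {G : SimpleGraph (Fin N)} [DecidableRel G.Adj] {lam : Fin N → ℝ}
  {u : OrthonormalBasis (Fin N) ℝ (EuclideanSpace ℝ (Fin N))}

/-- Symmetry moves the Laplacian onto the eigenvector; this is what decouples the modes. -/
theorem sum_mul_mulVec (hu : IsLaplacianEigensystem G lam u) (i : Fin N) (x : Fin N → ℝ) :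
    ∑ k, u i k * (G.lapMatrix ℝ *ᵥ x) k = lam i * ∑ k, u i k * x k := by
  have h1 : (u i).ofLp ⬝ᵥ (G.lapMatrix ℝ *ᵥ x) = lam i * ((u i).ofLp ⬝ᵥ x) := by
    rw [Matrix.dotProduct_mulVec, ← Matrix.mulVec_transpose, (G.isSymm_lapMatrix (R := ℝ)).eq,
      hu.eigen, smul_dotProduct, smul_eq_mul]
  exact h1

theorem sum_mul_eq_ite (u : OrthonormalBasis (Fin N) ℝ (EuclideanSpace ℝ (Fin N)))
    (i l : Fin N) : ∑ k, u i k * u l k = if i = l then 1 else 0 := by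
  rw [← u.inner_eq_ite i l, PiLp.inner_apply]
  simp [mul_comm]

theorem nonneg (hu : IsLaplacianEigensystem G lam u) (i : Fin N) : 0 ≤ lam i := by
  have h1 := (G.posSemidef_lapMatrix ℝ).dotProduct_mulVec_nonneg (u i).ofLp
  have h2 := hu.sum_mul_mulVec i (u i).ofLp
  rw [sum_mul_eq_ite u i i, if_pos rfl, mul_one] at h2
  rw [← h2]
  simpa [dotProduct] using h1

theorem apply_eq_of_eq_zero (hu : IsLaplacianEigensystem G lam u) (hG : G.Connected) {i : Fin N}
    (hi : lam i = 0) (k l : Fin N) : u i k = u i l := by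
  have h := hu.eigen i
  rw [hi, zero_smul, SimpleGraph.lapMatrix_mulVec_eq_zero_iff_forall_reachable] at h
  exact h k l (hG.preconnected k l)

/-- Constants lie in the kernel of the Laplacian, and eigenvectors for different eigenvalues are
orthogonal. -/
theorem sum_eq_zero_of_ne_zero (hu : IsLaplacianEigensystem G lam u) {i : Fin N}
    (hi : lam i ≠ 0) : ∑ k, u i k = 0 := by
  have h := hu.sum_mul_mulVec i (fun _ => 1)
  have h0 : G.lapMatrix ℝ *ᵥ (fun _ => (1 : ℝ)) = 0 := G.lapMatrix_mulVec_const_eq_zero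
  simp only [h0, Pi.zero_apply, mul_zero, Finset.sum_const_zero, mul_one] at h
  exact (mul_eq_zero.1 h.symm).resolve_left hi

theorem sum_mul_sum_mul (u : OrthonormalBasis (Fin N) ℝ (EuclideanSpace ℝ (Fin N)))
    (x : Fin N → ℝ) (j : Fin N) : ∑ i, u i j * ∑ k, u i k * x k = x j := by
  have h := congrArg (fun v : EuclideanSpace ℝ (Fin N) => v j) (u.sum_repr' (WithLp.toLp 2 x))
  simp only [PiLp.inner_apply] at h
  simpa [mul_comm] using h

/-- A second zero eigenvalue would, by monotonicity, come with `lam 0 = 0`. On a connected graph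
both eigenvectors would then be constant, and two constant unit vectors are not orthogonal. -/
theorem pos (hu : IsLaplacianEigensystem G lam u) (hG : G.Connected) {i : Fin N}
    (hi : i.val ≠ 0) : 0 < lam i := by
  have hN : 0 < N := i.pos
  by_contra hn
  have hi0 : lam i = 0 := le_antisymm (not_lt.1 hn) (hu.nonneg i)
  set z : Fin N := ⟨0, hN⟩ with hz
  have hz0 : lam z = 0 :=
    le_antisymm (hi0 ▸ hu.monotone (by rw [Fin.le_def]; simp [hz])) (hu.nonneg z)
  have hiz : i ≠ z := fun h => hi (by rw [h])
  have ci := hu.apply_eq_of_eq_zero hG hi0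
  have cz := hu.apply_eq_of_eq_zero hG hz0
  have h1 := sum_mul_eq_ite u i z
  have h2 := sum_mul_eq_ite u i i
  have h3 := sum_mul_eq_ite u z z
  simp only [if_neg hiz, if_true, ci _ z, cz _ z, Finset.sum_const, Finset.card_univ,
    Fintype.card_fin, nsmul_eq_mul] at h1 h2 h3
  have : (N : ℝ) ≠ 0 := by positivity
  rcases mul_eq_zero.1 ((mul_eq_zero.1 h1).resolve_left this) with h | h
  · simp [h] at h2
  · simp [h] at h3

/-- Subtracting the mean is the orthogonal projection off the constants, which are spanned by the
eigenvector of index `0`. -/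
theorem deviation_eq (hu : IsLaplacianEigensystem G lam u) (hG : G.Connected)
    (x : Fin N ⊕ Fin N → ℝ) (j : Fin N) :
    deviation x j
      = ∑ i : Fin N with i.val ≠ 0, u i j * ∑ k, u i k * x (Sum.inl k) := by
  have hN : (N : ℝ) ≠ 0 := by have := j.pos; positivity
  have hx := sum_mul_sum_mul u fun k => x (Sum.inl k)
  have hmean : (1 / (N : ℝ)) * ∑ k, x (Sum.inl k)
      = ∑ i, ((1 / (N : ℝ)) * ∑ k, u i k) * ∑ k, u i k * x (Sum.inl k) := by
    rw [Finset.sum_congr rfl fun k _ => (hx k).symm, Finset.sum_comm, Finset.mul_sum]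
    refine Finset.sum_congr rfl fun i _ => ?_
    rw [← Finset.sum_mul, mul_assoc]
  rw [deviation, hmean, ← hx j, ← Finset.sum_sub_distrib, Finset.sum_filter]
  refine Finset.sum_congr rfl fun i _ => ?_
  rw [← sub_mul]
  split_ifs with hi
  · rw [hu.sum_eq_zero_of_ne_zero (hu.pos hG hi).ne', mul_zero, sub_zero]
  -- The vanishing of the lowest eigenvalue is derived: otherwise every eigenvector would have zero
  -- sum, and the expansion of the constant `1` in the basis would be zero.
  · have hi0 : lam i = 0 := by
      by_contra hne
      have hs := hu.sum_eq_zero_of_ne_zero hne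
      have hone := sum_mul_sum_mul u (fun _ => (1 : ℝ)) j
      rw [Finset.sum_eq_zero] at hone
      · exact zero_ne_one hone
      intro l _
      simp only [mul_one]
      by_cases hl : l.val ≠ 0
      · rw [hu.sum_eq_zero_of_ne_zero (hu.pos hG hl).ne', mul_zero]
      · rw [show l = i from Fin.ext (by omega), hs, mul_zero]
    simp_rw [fun k => hu.apply_eq_of_eq_zero hG hi0 k j]
    simp [hN]

end IsLaplacianEigensystem

/-! ### Modal decomposition and the steady-state variance -/

/-- The modal coordinates of a solution solve scalar damped oscillator equations. -/
theorem IsConsensusSolution.modal {N : ℕ} {G : SimpleGraph (Fin N)} [DecidableRel G.Adj]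
    {lam : Fin N → ℝ} {u : OrthonormalBasis (Fin N) ℝ (EuclideanSpace ℝ (Fin N))}
    (hu : IsLaplacianEigensystem G lam u) {x : ℝ → Fin N ⊕ Fin N → ℝ} {w : Fin N → ℝ≥0 → ℝ}
    (hx : ContinuousOn x (Set.Ici 0)) (hw : ∀ k, Continuous (w k)) (hw0 : ∀ k, w k 0 = 0)
    (heq : ∀ t, 0 ≤ t → ∀ k, x t k = x 0 k + (∫ s in (0 : ℝ)..t, (systemMatrix G *ᵥ x s) k)
      + (inputMatrix N *ᵥ fun i => w i t.toNNReal) k)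
    (i : Fin N) {φ ψ : ℝ → ℝ} (h : IsImpulseResponse (lam i) φ ψ) {t : ℝ} (ht : 0 ≤ t) :
    ∑ k, u i k * x t (Sum.inl k) = (ψ t + lam i * φ t) * ∑ k, u i k * x 0 (Sum.inl k)
      + φ t * ∑ k, u i k * x 0 (Sum.inr k)
      + ∫ s in (0 : ℝ)..t, ψ (t - s) * ∑ k, u i k * w k s.toNNReal := by
  have hxk : ∀ k, ContinuousOn (fun s => x s k) (Set.Ici 0) := fun k =>
    (continuous_apply k).comp_continuousOn hx
  have hint : ∀ {f : ℝ → ℝ} {s : ℝ}, 0 ≤ s → ContinuousOn f (Set.Ici 0) →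
      IntervalIntegrable f volume 0 s := fun {f s} hs hf =>
    (hf.mono (by rw [Set.uIcc_of_le hs]; exact Set.Icc_subset_Ici_self)).intervalIntegrable
  have hcL : ∀ v : Fin N → ℝ → ℝ, (∀ k, ContinuousOn (v k) (Set.Ici 0)) → ∀ k,
      ContinuousOn (fun s => (G.lapMatrix ℝ *ᵥ fun l => v l s) k) (Set.Ici 0) := fun v hv k => by
    simp only [Matrix.mulVec, dotProduct]
    exact continuousOn_finsetSum _ fun l _ => continuousOn_const.mul (hv l)
  have hcs : ∀ v : Fin N → ℝ → ℝ, (∀ k, ContinuousOn (v k) (Set.Ici 0)) →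
      ContinuousOn (fun s => ∑ k, u i k * v k s) (Set.Ici 0) := fun v hv =>
    continuousOn_finsetSum _ fun l _ => continuousOn_const.mul (hv l)
  have hcm : ∀ (c : ℝ) {f : ℝ → ℝ}, ContinuousOn f (Set.Ici 0) →
      ContinuousOn (fun s => c * f s) (Set.Ici 0) := fun c f hf => continuousOn_const.mul hf
  refine h.eq_of_integral_equation (y := fun t => ∑ k, u i k * x t (Sum.inl k))
    (z := fun t => ∑ k, u i k * x t (Sum.inr k)) (b := fun t => ∑ k, u i k * w k t.toNNReal)
    (hcs _ fun k => hxk _) (hcs _ fun k => hxk _)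
    (hcs _ fun k => ((hw k).comp continuous_real_toNNReal).continuousOn) (by simp [hw0])
    (fun t ht => ?_) (fun t ht => ?_) ht
  · have e : ∀ k, x t (Sum.inl k) = x 0 (Sum.inl k) + ∫ s in (0 : ℝ)..t, x s (Sum.inr k) :=
      fun k => by
        rw [heq t ht (Sum.inl k)]
        simp [systemMatrix, inputMatrix, Matrix.fromBlocks_mulVec, Matrix.fromRows_mulVec]
    simp_rw [e, mul_add, Finset.sum_add_distrib]
    rw [intervalIntegral.integral_finsetSum fun k _ => hint ht (hcm _ (hxk (Sum.inr k)))]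
    simp_rw [intervalIntegral.integral_const_mul]
  · have e : ∀ k, x t (Sum.inr k) = x 0 (Sum.inr k) + (∫ s in (0 : ℝ)..t,
        (-(G.lapMatrix ℝ *ᵥ fun l => x s (Sum.inl l)) k
          - (G.lapMatrix ℝ *ᵥ fun l => x s (Sum.inr l)) k)) + w k t.toNNReal :=
      fun k => by
        rw [heq t ht (Sum.inr k)]
        simp [systemMatrix, inputMatrix, Matrix.fromBlocks_mulVec, Matrix.fromRows_mulVec,
          Matrix.neg_mulVec, Function.comp_def, sub_eq_add_neg]
    simp_rw [e, mul_add, Finset.sum_add_distrib]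
    congr 2
    simp_rw [← intervalIntegral.integral_const_mul]
    rw [← intervalIntegral.integral_finsetSum fun k _ => hint ht (hcm _
      ((hcL _ (fun l => hxk (Sum.inl l)) k).fun_neg.fun_sub
        (hcL _ (fun l => hxk (Sum.inr l)) k)))]
    refine intervalIntegral.integral_congr fun s _ => ?_
    simp only [mul_sub, mul_neg, Finset.sum_sub_distrib, Finset.sum_neg_distrib,
      hu.sum_mul_mulVec, neg_mul]

/-- Parseval's identity for the vector with coefficients `c i`, `i ∈ S`. -/
theorem sum_sq_sum_mul {N : ℕ} (u : OrthonormalBasis (Fin N) ℝ (EuclideanSpace ℝ (Fin N)))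
    (S : Finset (Fin N)) (c : Fin N → ℝ) :
    ∑ k, (∑ i ∈ S, c i * u i k) ^ 2 = ∑ i ∈ S, c i ^ 2 := by
  simp only [sq, Finset.sum_mul_sum]
  rw [Finset.sum_comm]
  refine Finset.sum_congr rfl fun i hi => ?_
  rw [Finset.sum_comm]
  simp_rw [mul_mul_mul_comm (c i), ← Finset.mul_sum, IsLaplacianEigensystem.sum_mul_eq_ite]
  simp [hi]

/-- The steady-state vertex variance of noisy second-order consensus. -/
theorem IsConsensusSolution.hasVertexVariance {N : ℕ} {G : SimpleGraph (Fin N)}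
    [DecidableRel G.Adj] (hG : G.Connected)
    {lam : Fin N → ℝ} {u : OrthonormalBasis (Fin N) ℝ (EuclideanSpace ℝ (Fin N))}
    (hu : IsLaplacianEigensystem G lam u)
    {Ω : Type*} [MeasurableSpace Ω] {P : Measure Ω} [IsProbabilityMeasure P]
    {W : Fin N → ℝ≥0 → Ω → ℝ} (hW : IsStandardBrownian W P)
    {X : ℝ → Ω → Fin N ⊕ Fin N → ℝ}
    (hX : IsConsensusSolution G W P X)
    (hX0 : ∀ k, MemLp (fun ω => X 0 ω k) 2 P)
    (j : Fin N) :
    HasVertexVariance P X j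
      (∑ i : Fin N with i.val ≠ 0, u i j ^ 2 / (2 * lam i ^ 2)) := by
  -- Impulse responses are chosen for all modes, including the undamped one of index `0`; decay is
  -- claimed only on `S`.
  choose φ ψ hφ using fun i => exists_isImpulseResponse (lam i)
  set S : Finset (Fin N) := Finset.univ.filter fun i => i.val ≠ 0 with hS
  have hpos : ∀ i ∈ S, 0 < lam i := fun i hi => hu.pos hG (Finset.mem_filter.1 hi).2
  -- The response to the initial state.
  let C : Fin N ⊕ Fin N → ℝ → ℝ := Sum.elim
    (fun k t => ∑ i ∈ S, u i j * (ψ i t + lam i * φ i t) * u i k)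
    (fun k t => ∑ i ∈ S, u i j * φ i t * u i k)
  have hC : ∀ k, Tendsto (C k) atTop (𝓝 0) := by
    have hφ0 : ∀ i ∈ S, Tendsto (φ i) atTop (𝓝 0) := fun i hi => (hφ i).tendsto_zero (hpos i hi)
    have hψ0 : ∀ i ∈ S, Tendsto (ψ i) atTop (𝓝 0) := fun i hi =>
      (hφ i).tendsto_deriv_zero (hpos i hi)
    rintro (k | k)
    · have := tendsto_finsetSum S fun i hi =>
        (((hψ0 i hi).add ((hφ0 i hi).const_mul (lam i))).const_mul (u i j)).mul_const (u i k)
      simp only [mul_zero, add_zero, zero_mul, Finset.sum_const_zero] at this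
      exact this
    · have := tendsto_finsetSum S fun i hi => ((hφ0 i hi).const_mul (u i j)).mul_const (u i k)
      simp only [mul_zero, zero_mul, Finset.sum_const_zero] at this
      exact this
  -- The response to the noise, a Wiener integral with integrand `F`.
  let F : ℝ → Fin N → ℝ → ℝ := fun t k s => ∑ i ∈ S, u i j * φ i (t - s) * u i k
  let K : ℝ → Fin N → ℝ → ℝ := fun t k s => ∑ i ∈ S, u i j * ψ i (t - s) * u i k
  have hψc : ∀ i t, Continuous fun s => ψ i (t - s) := fun i t =>
    (hφ i).continuous_deriv.comp (by fun_prop)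
  have hφc : ∀ i t, Continuous fun s => φ i (t - s) := fun i t =>
    (hφ i).continuous.comp (by fun_prop)
  have hK : ∀ t k, Continuous (K t k) := fun t k =>
    continuous_finsetSum _ fun i _ => ((hψc i t).const_mul _).mul_const _
  -- With `hFt`, which holds because `φ i 0 = 0`, this makes the time integral of `K * W` the
  -- integration by parts of a Wiener integral, without boundary terms.
  have hF : ∀ t k s, HasDerivAt (F t k) (-K t k s) s := fun t k s => by
    have e : HasDerivAt (fun s : ℝ => t - s) (-1) s := by
      simpa using (hasDerivAt_id s).const_sub t
    refine (HasDerivAt.fun_sum fun i _ =>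
      ((((hφ i).hasDerivAt (t - s)).comp s e).const_mul (u i j)).mul_const (u i k)).congr_deriv ?_
    simp [K]
  have hFt : ∀ t k, F t k t = 0 := fun t k => by simp [F, (hφ _).zero]
  have hwiener := fun t ht => hW.wiener_isometry (hF t) (hK t) (t := t) ht (hFt t)
  -- Summing over the noise channels `k` kills the products of different modes by orthonormality;
  -- the substitution `s ↦ t - s` then removes `t` from the integrand.
  have hvar : ∀ t, 0 ≤ t → ∑ k, ∫ s in (0 : ℝ)..t, F t k s ^ 2
      = ∑ i ∈ S, u i j ^ 2 * ∫ s in (0 : ℝ)..t, φ i s ^ 2 := fun t ht => by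
    have hFc : ∀ k, Continuous fun s => F t k s ^ 2 := fun k =>
      (continuous_finsetSum _ fun i _ => ((hφc i t).const_mul _).mul_const _).pow 2
    have hφc2 : ∀ i, Continuous fun s => φ i (t - s) ^ 2 := fun i => (hφc i t).pow 2
    rw [← intervalIntegral.integral_finsetSum fun k _ => (hFc k).intervalIntegrable _ _]
    simp only [F, sum_sq_sum_mul u S, mul_pow]
    rw [intervalIntegral.integral_finsetSum fun i _ =>
      ((hφc2 i).const_mul _).intervalIntegrable _ _]
    refine Finset.sum_congr rfl fun i _ => ?_
    rw [intervalIntegral.integral_const_mul,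
      intervalIntegral.integral_comp_sub_left (fun s => φ i s ^ 2), sub_self, sub_zero]
  have hdev : ∀ t, 0 ≤ t → ∀ᵐ ω ∂P, deviation (X t ω) j = ∑ k, C k t * X 0 ω k
      + ∫ s in (0 : ℝ)..t, ∑ k, K t k s * W k s.toNNReal ω := fun t ht => by
    filter_upwards [hX.continuousOn, hX.eqn, ae_all_iff.2 fun k => (hW.brownian k).cont,
      ae_all_iff.2 fun k => (hW.brownian k).eval_zero_ae_eq_zero] with ω hc heq hw hw0
    rw [hu.deviation_eq hG, ← hS]
    simp_rw [fun i => IsConsensusSolution.modal hu hc hw hw0 heq i (hφ i) ht]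
    have hwc : ∀ k, Continuous fun s : ℝ => W k s.toNNReal ω := fun k =>
      (hw k).comp continuous_real_toNNReal
    have hI : ∫ s in (0 : ℝ)..t, ∑ k, K t k s * W k s.toNNReal ω
        = ∑ i ∈ S, u i j * ∫ s in (0 : ℝ)..t, ψ i (t - s) * ∑ k, u i k * W k s.toNNReal ω := by
      simp_rw [← intervalIntegral.integral_const_mul]
      rw [← intervalIntegral.integral_finsetSum]
      · refine intervalIntegral.integral_congr fun s _ => ?_
        simp only [K, Finset.sum_mul, Finset.mul_sum]
        rw [Finset.sum_comm]
        simp only [mul_assoc]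
      · intro i _
        exact (((hψc i t).mul (continuous_finsetSum _ fun k _ =>
          (hwc k).const_mul _)).const_mul _).intervalIntegrable _ _
    rw [hI, Fintype.sum_sum_type]
    simp only [C, Sum.elim_inl, Sum.elim_inr, mul_add, Finset.sum_add_distrib]
    congr 2 <;>
    · simp only [Finset.sum_mul, Finset.mul_sum]
      rw [Finset.sum_comm]
      simp only [mul_assoc, mul_add, add_mul]
  have hL : ∀ t, MemLp (fun ω => ∑ k, C k t * X 0 ω k) 2 P := fun t =>
    memLp_finsetSum _ fun k _ => (hX0 k).const_mul _
  refine ⟨fun t ht => ?_, ?_⟩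
  · refine (((hL t).add (hwiener t ht).1).integrable_sq).congr ?_
    filter_upwards [hdev t ht] with ω hω
    rw [hω, Pi.add_apply]
  · have hv : Tendsto (fun t => ∫ ω, (∫ s in (0 : ℝ)..t, ∑ k, K t k s * W k s.toNNReal ω) ^ 2 ∂P)
        atTop (𝓝 (∑ i ∈ S, u i j ^ 2 / (2 * lam i ^ 2))) := by
      have := tendsto_finsetSum S fun i hi =>
        ((hφ i).tendsto_integral_sq (hpos i hi)).const_mul (u i j ^ 2)
      simp only [mul_one_div] at this
      refine this.congr' ?_
      filter_upwards [eventually_ge_atTop 0] with t ht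
      rw [(hwiener t ht).2, hvar t ht]
    have hlim := tendsto_integral_add_sq (Eventually.of_forall hL)
      ((eventually_ge_atTop 0).mono fun t ht => (hwiener t ht).1)
      (tendsto_integral_sum_sq hX0 hC) hv
    refine hlim.congr' ?_
    filter_upwards [eventually_ge_atTop 0] with t ht
    exact integral_congr_ae ((hdev t ht).mono fun ω hω => by simp only [hω])

end SecondOrderConsensus

theorem mainTheorem5 {N : ℕ} (G : SimpleGraph (Fin N)) [DecidableRel G.Adj] (hG : G.Connected)
    (lam : Fin N → ℝ) (u : OrthonormalBasis (Fin N) ℝ (EuclideanSpace ℝ (Fin N)))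
    (hu : SecondOrderConsensus.IsLaplacianEigensystem G lam u)
    {Ω : Type*} [MeasurableSpace Ω] (P : Measure Ω) [IsProbabilityMeasure P]
    (W : Fin N → ℝ≥0 → Ω → ℝ) (hW : SecondOrderConsensus.IsStandardBrownian W P)
    (X : ℝ → Ω → Fin N ⊕ Fin N → ℝ)
    (hX : SecondOrderConsensus.IsConsensusSolution G W P X)
    (hX0 : ∀ k, MemLp (fun ω => X 0 ω k) 2 P)
    (j : Fin N) :
    SecondOrderConsensus.HasVertexVariance P X j
      (∑ i : Fin N with i.val ≠ 0, u i j ^ 2 / (2 * lam i ^ 2)) :=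
  SecondOrderConsensus.IsConsensusSolution.hasVertexVariance hG hu hW hX hX0 j
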